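/- Let $\mathbb F=\mathbb R$ or $\mathbb C$. For a Hermitian operator $A$ on a finite-dimensional Hilbert space $\mathcal H$ over $\mathbb F$ with spectral decomposition $A=\sum_\mu \mu P_\mu$, put $f(A)=\sum_\mu f(\mu)P_\mu$. A density operator is a Hermitian positive semi-definite operator of trace one; its support $\operatorname{supp}(\rho)$ is the span of its eigenvectors with strictly positive eigenvalue. The relative entropy of two density operators $\rho,\sigma$ on $\mathcal H$ is $$S(\rho\|\sigma)=\operatorname{Tr}(\rho\log\rho-\rho\log\sigma)\ \text{ if }\operatorname{supp}(\rho)\subseteq\operatorname{supp}(\sigma),\qquad S(\rho\|\sigma)=+\infty\ \text{ otherwise,}$$ with the convention $0\log 0=0$ (kernels contribute nothing). The partial trace $\operatorname{Tr}_b$ is the linear map from operators on $\mathcal H_a\otimes\mathcal H_b$ to operators on $\mathcal H_a$ with $\operatorname{Tr}_b(X_a\otimes X_b)=\operatorname{Tr}(X_b)X_a$. A channel is a linear map $\mathcal C:\mathcal B(\mathcal H)\to\mathcal B(\mathcal K)$, with $\mathcal H,\mathcal K$ finite-dimensional Hilbert spaces over $\mathbb F$, that preserves the trace and is completely positive: for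 every finite-dimensional Hilbert space $\mathcal E$ over $\mathbb F$, $\mathcal C\otimes \mathrm{id}_{\mathcal B(\mathcal E)}$ maps Hermitian positive semi-definite operators to Hermitian positive semi-definite operators. (1) (The support-based and the regularized definition agree.) For all density operators $\rho,\sigma$ on a finite-dimensional $\mathcal H$, with $\rho_\varepsilon=\rho+\varepsilon\,\mathrm{id}$ and $\sigma_\varepsilon=\sigma+\varepsilon\,\mathrm{id}$, $$\lim_{\varepsilon\to0^+}\operatorname{Tr}(\rho_\varepsilon\log\rho_\varepsilon-\rho_\varepsilon\log\sigma_\varepsilon)=S(\rho\|\sigma)\quad\text{in }[-\infty,+\infty].$$ (2) (Monotonicity under the partial trace.) For all density operators $\rho,\sigma$, invertible or not, on $\mathcal H_a\otimes\mathcal H_b$ with $\mathcal H_a,\mathcal H_b$ finite-dimensional, $\operatorname{Tr}_b\rho$ and $\operatorname{Tr}_b\sigma$ are density operators and $$S(\operatorname{Tr}_b\rho\,\|\,\operatorname{Tr}_b\sigma)\le S(\rho\|\sigma).$$ (3) (Data-processing inequality.) For every channel $\mathcal C:\mathcal B(\mathcal H)\to\mathcal B(\mathcal K)$ and all density operators $\rho,\sigma$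 on $\mathcal H$, $\mathcal C(\rho)$ and $\mathcal C(\sigma)$ are density operators and $$S(\mathcal C(\rho)\,\|\,\mathcal C(\sigma))\le S(\rho\|\sigma).$$ -/

import Mathlib

open Filter Topology
open scoped TensorProduct InnerProductSpace

namespace QuantumEntropy

section SingleSystem

variable {𝕜 : Type*} [RCLike 𝕜] {H : Type*} [NormedAddCommGroup H] [InnerProductSpace 𝕜 H]

/-- A density operator: Hermitian, positive semi-definite (both are part of
`LinearMap.IsPositive`) and of trace one. -/
structure IsDensityOperator (ρ : H →ₗ[𝕜] H) : Prop where
  isPositive : ρ.IsPositive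
  trace_eq_one : LinearMap.trace 𝕜 H ρ = 1

/-- The support of an operator: the span of its eigenvectors with strictly positive eigenvalue. -/
def supp (A : H →ₗ[𝕜] H) : Submodule 𝕜 H :=
  ⨆ (μ : ℝ) (_ : 0 < μ), Module.End.eigenspace A (μ : 𝕜)

variable [FiniteDimensional 𝕜 H]

/-- The functional calculus of a Hermitian operator `A = ∑ μ P_μ`, namely `f(A) = ∑ f(μ) P_μ`, the
sum being over the (real) eigenvalues `μ` of `A` and `P_μ` being the orthogonal projection onto the
eigenspace of `μ`. -/
noncomputable def applyFun (f : ℝ → ℝ) (A : H →ₗ[𝕜] H) : H →ₗ[𝕜] H :=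
  ∑ μ : Module.End.Eigenvalues A, ((f (RCLike.re (μ : 𝕜)) : ℝ) : 𝕜) •
    ((Module.End.eigenspace A (μ : 𝕜)).starProjection : H →ₗ[𝕜] H)

/-- The logarithm of a positive semi-definite operator. Since `Real.log 0 = 0`, the kernel
contributes nothing; this is the convention `0 log 0 = 0` wherever `logOp σ` is multiplied by an
operator whose support lies in the support of `σ`. -/
noncomputable def logOp (A : H →ₗ[𝕜] H) : H →ₗ[𝕜] H := applyFun Real.log A

/-- The real number `Tr(A log A - A log B)`. -/
noncomputable def entropyTrace (A B : H →ₗ[𝕜] H) : ℝ :=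
  RCLike.re (LinearMap.trace 𝕜 H (A ∘ₗ logOp A - A ∘ₗ logOp B))

open Classical in
/-- The relative entropy `S(ρ‖σ)`, support-based definition: `Tr(ρ log ρ - ρ log σ)` if
`supp ρ ⊆ supp σ`, and `+∞` otherwise. -/
noncomputable def relEntropy (ρ σ : H →ₗ[𝕜] H) : EReal :=
  if supp ρ ≤ supp σ then ((entropyTrace ρ σ : ℝ) : EReal) else ⊤

/-- The regularized operator `A_ε = A + ε id`. -/
noncomputable def regularize (ε : ℝ) (A : H →ₗ[𝕜] H) : H →ₗ[𝕜] H :=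
  A + (ε : 𝕜) • LinearMap.id

end SingleSystem

section CompositeSystem

variable {𝕜 : Type*} [RCLike 𝕜]
  {Ha : Type*} [NormedAddCommGroup Ha] [InnerProductSpace 𝕜 Ha] [FiniteDimensional 𝕜 Ha]
  {Hb : Type*} [NormedAddCommGroup Hb] [InnerProductSpace 𝕜 Hb] [FiniteDimensional 𝕜 Hb]

/-- The partial trace over the second tensor factor: the linear map with
`X_a ⊗ X_b ↦ Tr(X_b) X_a`. -/
noncomputable def partialTrace :
    (Ha ⊗[𝕜] Hb →ₗ[𝕜] Ha ⊗[𝕜] Hb) →ₗ[𝕜] (Ha →ₗ[𝕜] Ha) :=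
  (TensorProduct.rid 𝕜 (Ha →ₗ[𝕜] Ha)).toLinearMap ∘ₗ
    LinearMap.lTensor (Ha →ₗ[𝕜] Ha) (LinearMap.trace 𝕜 Hb) ∘ₗ
    (homTensorHomEquiv 𝕜 Ha Hb Ha Hb).symm.toLinearMap

theorem partialTrace_map (X : Ha →ₗ[𝕜] Ha) (Y : Hb →ₗ[𝕜] Hb) :
    partialTrace (TensorProduct.map X Y) = LinearMap.trace 𝕜 Hb Y • X := by
  have h : (homTensorHomEquiv 𝕜 Ha Hb Ha Hb).symm (TensorProduct.map X Y) = X ⊗ₜ[𝕜] Y := by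
    rw [LinearEquiv.symm_apply_eq, homTensorHomEquiv_apply]
    rfl
  simp [partialTrace, h]

end CompositeSystem

section Channels

variable {𝕜 : Type*} [RCLike 𝕜]
  {H : Type*} [NormedAddCommGroup H] [InnerProductSpace 𝕜 H] [FiniteDimensional 𝕜 H]
  {K : Type*} [NormedAddCommGroup K] [InnerProductSpace 𝕜 K] [FiniteDimensional 𝕜 K]

/-- For a superoperator `Φ : B(H) → B(K)`, the superoperator `Φ ⊗ id : B(H ⊗ E) → B(K ⊗ E)`. -/
noncomputable def ampliation (Φ : (H →ₗ[𝕜] H) →ₗ[𝕜] (K →ₗ[𝕜] K))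
    (E : Type*) [NormedAddCommGroup E] [InnerProductSpace 𝕜 E] [FiniteDimensional 𝕜 E] :
    (H ⊗[𝕜] E →ₗ[𝕜] H ⊗[𝕜] E) →ₗ[𝕜] (K ⊗[𝕜] E →ₗ[𝕜] K ⊗[𝕜] E) :=
  (homTensorHomEquiv 𝕜 K E K E).toLinearMap ∘ₗ
    LinearMap.rTensor (E →ₗ[𝕜] E) Φ ∘ₗ
    (homTensorHomEquiv 𝕜 H E H E).symm.toLinearMap

theorem ampliation_map (Φ : (H →ₗ[𝕜] H) →ₗ[𝕜] (K →ₗ[𝕜] K))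
    (E : Type*) [NormedAddCommGroup E] [InnerProductSpace 𝕜 E] [FiniteDimensional 𝕜 E]
    (X : H →ₗ[𝕜] H) (Y : E →ₗ[𝕜] E) :
    ampliation Φ E (TensorProduct.map X Y) = TensorProduct.map (Φ X) Y := by
  have h : (homTensorHomEquiv 𝕜 H E H E).symm (TensorProduct.map X Y) = X ⊗ₜ[𝕜] Y := by
    rw [LinearEquiv.symm_apply_eq, homTensorHomEquiv_apply]
    rfl
  simp [ampliation, h]

/-- A quantum channel: a trace-preserving and completely positive linear map. Every
finite-dimensional ancilla is, up to a unitary, one of the spaces `𝕜ⁿ`. -/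
structure IsChannel (Φ : (H →ₗ[𝕜] H) →ₗ[𝕜] (K →ₗ[𝕜] K)) : Prop where
  completely_positive : ∀ (n : ℕ)
    (T : H ⊗[𝕜] EuclideanSpace 𝕜 (Fin n) →ₗ[𝕜] H ⊗[𝕜] EuclideanSpace 𝕜 (Fin n)),
    T.IsPositive → (ampliation Φ (EuclideanSpace 𝕜 (Fin n)) T).IsPositive
  trace_preserving : ∀ X : H →ₗ[𝕜] H,
    LinearMap.trace 𝕜 K (Φ X) = LinearMap.trace 𝕜 H X

end Channels

end QuantumEntropy

/-!
In orthonormal eigenbases `ρ eᵢ = pᵢ eᵢ` and `σ gⱼ = qⱼ gⱼ`, the relative entropy is a sum over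
pairs of eigenvalues,
`S(ρ‖σ) = ∑ᵢⱼ wᵢⱼ pᵢ (log pᵢ - log qⱼ)` with `wᵢⱼ = |⟨gⱼ, eᵢ⟩|²`,
and `supp ρ ⊆ supp σ` says that no weight `wᵢⱼ` with `qⱼ = 0 < pᵢ` is nonzero
(`entropyTrace_eq_sum`, `supp_le_supp_iff`). The regularization shifts all `pᵢ` and `qⱼ` by `ε`, so
its limit is taken term by term. A term with `wᵢⱼ ≠ 0` and `qⱼ = 0 < pᵢ` tends to `+∞`, and no term
tends to `-∞` because `x (log x - log y) ≥ x - y`.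

For monotonicity, consider `D(t) = ∑ wᵢⱼ pᵢ log (qⱼ + t pᵢ)` for `t > 0`. As `t → ∞`,
`D(t) - log t` tends to `Tr ρ log ρ`. As `t → 0`, `D(t)` tends to `Tr ρ log σ` if
`supp ρ ⊆ supp σ`, and to `-∞` otherwise. So, if `D'` increases under passage from the image pair
to the original pair, comparing the two limits gives the inequality of relative entropies and, at
the same time, the inclusion of the supports for the image pair (`sum_mul_log_sub_log_le`,
`ne_zero_of_forall_sum_sq_div_le`). This argument needs neither invertible operators nor an improper
integral. The derivative is
`D'(t) = ∑ wᵢⱼ pᵢ² / (qⱼ + t pᵢ) = max_Y (2 Re Tr(Y⋆ρ) - Tr(Y⋆σY) - t Tr(YρY⋆))`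
(`variationalForm_le`, `exists_variationalForm_eq`), the maximum being found by completing the
square in each matrix entry of `Y`.

Thus it is enough to send each test operator `Y` on the image space to a test operator `X` on the
original space with the same linear term and no larger quadratic terms
(`relEntropy_le_of_forall_exists`). For the partial trace, `X = Y ⊗ 1` works, with equalities. For a
channel `Φ`, let `X` be the image of `Y` under the adjoint of `Φ` for the trace pairing. The
inequality `Tr(X⋆σX) ≤ Tr(Y⋆Φ(σ)Y)` is the trace of the positive operator
`Y⋆Φ(σ)Y - Y⋆Φ(σX) - Φ(X⋆σ)Y + Φ(X⋆σX)`, a compression of the amplification of `Φ` applied to the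
positive block operator with blocks `σ`, `σX`, `X⋆σ`, `X⋆σX` (`IsChannel.isPositive_schwarz`).
-/


/-! ### Weighted sums over pairs of eigenvalues -/

namespace QuantumEntropy

section Classical

variable {ι : Type*} [Fintype ι] {w p q : ι → ℝ}

theorem tendsto_sum_atTop_of_bddBelow {α : Type*} {l : Filter α} {f : ι → α → ℝ}
    (hf : ∀ k, ∃ c, ∀ᶠ x in l, c ≤ f k x) (k₀ : ι) (h₀ : Tendsto (f k₀) l atTop) :
    Tendsto (fun x => ∑ k, f k x) l atTop := by
  classical
  choose c hc using hf
  have hsum : ∀ x, ∑ k, f k x = f k₀ x + ∑ k ∈ Finset.univ.erase k₀, f k x := fun x =>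
    (Finset.add_sum_erase _ _ (Finset.mem_univ k₀)).symm
  simp_rw [hsum]
  refine tendsto_atTop_add_right_of_le' l (∑ k ∈ Finset.univ.erase k₀, c k) h₀ ?_
  filter_upwards [eventually_all.2 hc] with x hx
  exact Finset.sum_le_sum fun k _ => hx k

theorem tendsto_const_add_nhdsGT_zero (x : ℝ) :
    Tendsto (fun ε : ℝ => x + ε) (𝓝[>] 0) (𝓝 x) :=
  ((continuous_const.add continuous_id).tendsto' 0 x (add_zero x)).mono_left nhdsWithin_le_nhds

/-- The regularized sum converges to the unregularized one when no weight is put on `q = 0 < p`. -/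
theorem tendsto_regularized_sum
    (hsupp : ∀ k, w k ≠ 0 → p k ≠ 0 → q k ≠ 0) :
    Tendsto (fun ε : ℝ => ∑ k, w k * ((p k + ε) * (Real.log (p k + ε) - Real.log (q k + ε))))
      (𝓝[>] 0) (𝓝 (∑ k, w k * (p k * (Real.log (p k) - Real.log (q k))))) := by
  refine tendsto_finsetSum _ fun k _ => ?_
  by_cases hw : w k = 0
  · simp [hw]
  refine Tendsto.const_mul _ ?_
  have hp_lim := tendsto_const_add_nhdsGT_zero (p k)
  have hq_lim := tendsto_const_add_nhdsGT_zero (q k)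
  by_cases hp : p k = 0
  · by_cases hq : q k = 0
    · simp [hp, hq]
    · have h1 := (Real.continuous_mul_log.tendsto (p k)).comp hp_lim
      have h2 := hp_lim.mul (hq_lim.log hq)
      simpa [mul_sub, Function.comp_def] using h1.sub h2
  · exact hp_lim.mul ((hp_lim.log hp).sub (hq_lim.log (hsupp k hw hp)))

theorem sub_le_mul_log_sub_log {x y : ℝ} (hx : 0 < x) (hy : 0 < y) :
    x - y ≤ x * (Real.log x - Real.log y) := by
  have h := Real.log_le_sub_one_of_pos (div_pos hy hx)
  rw [Real.log_div hy.ne' hx.ne'] at h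
  have h' := mul_le_mul_of_nonneg_left h hx.le
  have : x * (y / x - 1) = y - x := by field_simp
  linarith

/-- The regularized sum diverges as soon as some weight is put on `q = 0 < p`. -/
theorem tendsto_regularized_sum_atTop (hw : ∀ k, 0 ≤ w k) (hp : ∀ k, 0 ≤ p k)
    (hq : ∀ k, 0 ≤ q k) (hsupp : ∃ k, w k ≠ 0 ∧ p k ≠ 0 ∧ q k = 0) :
    Tendsto (fun ε : ℝ => ∑ k, w k * ((p k + ε) * (Real.log (p k + ε) - Real.log (q k + ε))))
      (𝓝[>] 0) atTop := by
  obtain ⟨k₀, hw₀, hp₀, hq₀⟩ := hsupp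
  refine tendsto_sum_atTop_of_bddBelow (fun k => ⟨w k * (p k - q k), ?_⟩) k₀ ?_
  · filter_upwards [self_mem_nhdsWithin] with ε hε
    have hε : 0 < ε := hε
    have := sub_le_mul_log_sub_log (add_pos_of_nonneg_of_pos (hp k) hε)
      (add_pos_of_nonneg_of_pos (hq k) hε)
    exact mul_le_mul_of_nonneg_left (by linarith) (hw k)
  · have hwpos : 0 < w k₀ := lt_of_le_of_ne (hw k₀) (Ne.symm hw₀)
    have hppos : 0 < p k₀ := lt_of_le_of_ne (hp k₀) (Ne.symm hp₀)
    have hid := tendsto_const_add_nhdsGT_zero (p k₀)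
    refine Tendsto.const_mul_atTop hwpos (hid.pos_mul_atTop hppos ?_)
    simp only [hq₀, zero_add, sub_eq_add_neg]
    exact (hid.log hp₀).add_atTop
      (tendsto_neg_atBot_atTop.comp Real.tendsto_log_nhdsGT_zero)

/-- The sum `∑ w p log (q + t p)`, which interpolates between `∑ w p log q` (for `t → 0`) and
`∑ w p log p` (for `t → ∞`, up to the divergence `log t`). -/
noncomputable def logSum (w p q : ι → ℝ) (t : ℝ) : ℝ :=
  ∑ k, w k * (p k * Real.log (q k + t * p k))

theorem hasDerivAt_logSum (hp : ∀ k, 0 ≤ p k) (hq : ∀ k, 0 ≤ q k) {t : ℝ} (ht : 0 < t) :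
    HasDerivAt (logSum w p q) (∑ k, w k * (p k ^ 2 / (q k + t * p k))) t := by
  refine HasDerivAt.fun_sum fun k _ => HasDerivAt.const_mul _ ?_
  rcases (hp k).eq_or_lt with h | h
  · simpa [← h] using hasDerivAt_const t (0 : ℝ)
  · have hpos : 0 < q k + t * p k := add_pos_of_nonneg_of_pos (hq k) (mul_pos ht h)
    have h1 : HasDerivAt (fun t : ℝ => q k + t * p k) (p k) t := by
      simpa using ((hasDerivAt_id t).mul_const (p k)).const_add (q k)
    convert (h1.log hpos.ne').const_mul (p k) using 1
    ring

theorem tendsto_logSum_sub_log_atTop (hp : ∀ k, 0 ≤ p k) (hsum : ∑ k, w k * p k = 1) :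
    Tendsto (fun t => logSum w p q t - Real.log t) atTop
      (𝓝 (∑ k, w k * (p k * Real.log (p k)))) := by
  have key : ∀ t : ℝ, logSum w p q t - Real.log t =
      ∑ k, w k * (p k * (Real.log (q k + t * p k) - Real.log t)) := by
    intro t
    have h : ∑ k, w k * (p k * Real.log t) = Real.log t := by
      simp_rw [← mul_assoc]
      rw [← Finset.sum_mul, hsum, one_mul]
    simp only [logSum, mul_sub, Finset.sum_sub_distrib, h]
  simp_rw [key]
  refine tendsto_finsetSum _ fun k _ => Tendsto.const_mul _ ?_
  rcases (hp k).eq_or_lt with h | h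
  · simp [← h]
  refine Tendsto.const_mul _ ?_
  have hlim : Tendsto (fun t : ℝ => q k / t + p k) atTop (𝓝 (p k)) := by
    simpa using (tendsto_const_nhds.div_atTop tendsto_id).add_const (p k)
  refine (hlim.log h.ne').congr' ?_
  filter_upwards [eventually_gt_atTop 0, hlim.eventually (eventually_ne_nhds h.ne')] with t ht hne
  have : q k + t * p k = (q k / t + p k) * t := by field_simp
  rw [this, Real.log_mul hne ht.ne']
  ring

theorem tendsto_logSum_nhdsGT_zero (hsupp : ∀ k, w k ≠ 0 → p k ≠ 0 → q k ≠ 0) :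
    Tendsto (logSum w p q) (𝓝[>] 0) (𝓝 (∑ k, w k * (p k * Real.log (q k)))) := by
  refine tendsto_finsetSum _ fun k _ => ?_
  by_cases hw : w k = 0
  · simp [hw]
  by_cases hp : p k = 0
  · simp [hp]
  refine Tendsto.const_mul _ (Tendsto.const_mul _ (Tendsto.log ?_ (hsupp k hw hp)))
  have hc : Continuous fun t : ℝ => q k + t * p k := by fun_prop
  exact (hc.tendsto' 0 _ (by simp)).mono_left nhdsWithin_le_nhds

theorem tendsto_neg_logSum_atTop (hw : ∀ k, 0 ≤ w k) (hp : ∀ k, 0 ≤ p k)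
    (hq : ∀ k, 0 ≤ q k) (hsupp : ∃ k, w k ≠ 0 ∧ p k ≠ 0 ∧ q k = 0) :
    Tendsto (fun t => -logSum w p q t) (𝓝[>] 0) atTop := by
  obtain ⟨k₀, hw₀, hp₀, hq₀⟩ := hsupp
  simp_rw [logSum, ← Finset.sum_neg_distrib]
  refine tendsto_sum_atTop_of_bddBelow
    (fun k => ⟨-(w k * (p k * Real.log (q k + p k))), ?_⟩) k₀ ?_
  · filter_upwards [Ioo_mem_nhdsGT (zero_lt_one' ℝ)] with t ht
    rcases (hp k).eq_or_lt with h | h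
    · simp [← h]
    refine neg_le_neg (mul_le_mul_of_nonneg_left (mul_le_mul_of_nonneg_left ?_ h.le) (hw k))
    refine Real.log_le_log (add_pos_of_nonneg_of_pos (hq k) (mul_pos ht.1 h)) ?_
    nlinarith [ht.2]
  · have hwpos : 0 < w k₀ := lt_of_le_of_ne (hw k₀) (Ne.symm hw₀)
    have hppos : 0 < p k₀ := lt_of_le_of_ne (hp k₀) (Ne.symm hp₀)
    refine tendsto_neg_atBot_atTop.comp
      (Tendsto.const_mul_atBot hwpos (Tendsto.const_mul_atBot hppos ?_))
    simp only [hq₀, zero_add]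
    refine Real.tendsto_log_nhdsGT_zero.comp (tendsto_nhdsWithin_iff.2 ⟨?_, ?_⟩)
    · have hc : Continuous fun t : ℝ => t * p k₀ := by fun_prop
      exact (hc.tendsto' 0 _ (by simp)).mono_left nhdsWithin_le_nhds
    · filter_upwards [self_mem_nhdsWithin] with t ht using mul_pos ht hppos

variable {κ : Type*} [Fintype κ] {w' p' q' : κ → ℝ}

/-- If the derivative of `logSum` is larger for `(w, p, q)` than for `(w', p', q')`, integrating the
difference from `t` to `∞` bounds the difference of the sums themselves. -/
theorem logSum_sub_logSum_le (hp : ∀ k, 0 ≤ p k) (hq : ∀ k, 0 ≤ q k)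
    (hp' : ∀ k, 0 ≤ p' k) (hq' : ∀ k, 0 ≤ q' k)
    (hsum : ∑ k, w k * p k = 1) (hsum' : ∑ k, w' k * p' k = 1)
    (hle : ∀ t, 0 < t → ∑ k, w' k * (p' k ^ 2 / (q' k + t * p' k)) ≤
      ∑ k, w k * (p k ^ 2 / (q k + t * p k))) {t : ℝ} (ht : 0 < t) :
    logSum w p q t - logSum w' p' q' t ≤
      ∑ k, w k * (p k * Real.log (p k)) - ∑ k, w' k * (p' k * Real.log (p' k)) := by
  have hder : ∀ s : ℝ, 0 < s → HasDerivAt (fun t => logSum w p q t - logSum w' p' q' t) _ s :=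
    fun s hs => (hasDerivAt_logSum hp hq hs).sub (hasDerivAt_logSum hp' hq' hs)
  have hmono : MonotoneOn (fun t => logSum w p q t - logSum w' p' q' t) (Set.Ioi 0) := by
    refine monotoneOn_of_deriv_nonneg (convex_Ioi 0)
      (fun s hs => (hder s hs).continuousAt.continuousWithinAt)
      (fun s hs => (hder s (by simpa using hs)).differentiableAt.differentiableWithinAt)
      fun s hs => ?_
    have hs : 0 < s := by simpa using hs
    rw [(hder s hs).deriv]
    exact sub_nonneg.2 (hle s hs)
  have hlim : Tendsto (fun t => logSum w p q t - logSum w' p' q' t) atTop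
      (𝓝 (∑ k, w k * (p k * Real.log (p k)) - ∑ k, w' k * (p' k * Real.log (p' k)))) := by
    refine ((tendsto_logSum_sub_log_atTop hp hsum (q := q)).sub
      (tendsto_logSum_sub_log_atTop hp' hsum' (q := q'))).congr fun t => ?_
    ring
  refine ge_of_tendsto hlim ?_
  filter_upwards [eventually_ge_atTop t] with s hs
  exact hmono ht (lt_of_lt_of_le ht hs) hs

/-- The inclusion of supports passes from `(w, p, q)` to `(w', p', q')`: otherwise `logSum w' p' q'`
would tend to `-∞` at `0` while bounding a convergent function from above. -/
theorem ne_zero_of_forall_sum_sq_div_le (hp : ∀ k, 0 ≤ p k) (hq : ∀ k, 0 ≤ q k)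
    (hw' : ∀ k, 0 ≤ w' k) (hp' : ∀ k, 0 ≤ p' k) (hq' : ∀ k, 0 ≤ q' k)
    (hsum : ∑ k, w k * p k = 1) (hsum' : ∑ k, w' k * p' k = 1)
    (hle : ∀ t, 0 < t → ∑ k, w' k * (p' k ^ 2 / (q' k + t * p' k)) ≤
      ∑ k, w k * (p k ^ 2 / (q k + t * p k)))
    (hsupp : ∀ k, w k ≠ 0 → p k ≠ 0 → q k ≠ 0) (k : κ) (hwk : w' k ≠ 0) (hpk : p' k ≠ 0) :
    q' k ≠ 0 := by
  intro hqk
  have hinf := tendsto_neg_logSum_atTop hw' hp' hq' ⟨k, hwk, hpk, hqk⟩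
  have hfin := (tendsto_logSum_nhdsGT_zero hsupp).const_sub
    (∑ k, w k * (p k * Real.log (p k)) - ∑ k, w' k * (p' k * Real.log (p' k)))
  refine not_tendsto_nhds_of_tendsto_atTop (tendsto_atTop_mono' _ ?_ hinf) _ hfin
  filter_upwards [self_mem_nhdsWithin] with t ht
  have := logSum_sub_logSum_le hp hq hp' hq' hsum hsum' hle ht
  linarith

/-- The limit `t → 0` of `logSum_sub_logSum_le`. -/
theorem sum_mul_log_sub_log_le (hp : ∀ k, 0 ≤ p k) (hq : ∀ k, 0 ≤ q k)
    (hp' : ∀ k, 0 ≤ p' k) (hq' : ∀ k, 0 ≤ q' k)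
    (hsum : ∑ k, w k * p k = 1) (hsum' : ∑ k, w' k * p' k = 1)
    (hle : ∀ t, 0 < t → ∑ k, w' k * (p' k ^ 2 / (q' k + t * p' k)) ≤
      ∑ k, w k * (p k ^ 2 / (q k + t * p k)))
    (hsupp : ∀ k, w k ≠ 0 → p k ≠ 0 → q k ≠ 0)
    (hsupp' : ∀ k, w' k ≠ 0 → p' k ≠ 0 → q' k ≠ 0) :
    ∑ k, w' k * (p' k * (Real.log (p' k) - Real.log (q' k))) ≤
      ∑ k, w k * (p k * (Real.log (p k) - Real.log (q k))) := by
  have hlim := (tendsto_logSum_nhdsGT_zero hsupp).sub (tendsto_logSum_nhdsGT_zero hsupp')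
  have := le_of_tendsto hlim (by
    filter_upwards [self_mem_nhdsWithin] with t ht
    exact logSum_sub_logSum_le hp hq hp' hq' hsum hsum' hle ht)
  simp only [mul_sub, Finset.sum_sub_distrib]
  linarith

end Classical

end QuantumEntropy

/-! ### Relative entropy in terms of eigenbases -/

namespace QuantumEntropy

section Spectral

variable {𝕜 : Type*} [RCLike 𝕜] {H : Type*} [NormedAddCommGroup H] [InnerProductSpace 𝕜 H]
  {ι κ : Type*} [Fintype ι] [Fintype κ] {A B : H →ₗ[𝕜] H}
  {e : OrthonormalBasis ι 𝕜 H} {a : ι → ℝ} {g : OrthonormalBasis κ 𝕜 H} {b : κ → ℝ}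

/-- The orthonormal basis `e` diagonalizes `A`, with real eigenvalues `a`. -/
def IsEigenbasis (A : H →ₗ[𝕜] H) (e : OrthonormalBasis ι 𝕜 H) (a : ι → ℝ) : Prop :=
  ∀ i, A (e i) = (a i : 𝕜) • e i

theorem exists_isEigenbasis [FiniteDimensional 𝕜 H] (hA : A.IsPositive) :
    ∃ (e : OrthonormalBasis (Fin (Module.finrank 𝕜 H)) 𝕜 H)
      (a : Fin (Module.finrank 𝕜 H) → ℝ), IsEigenbasis A e a ∧ ∀ i, 0 ≤ a i :=
  ⟨hA.isSymmetric.eigenvectorBasis rfl, hA.isSymmetric.eigenvalues rfl,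
    hA.isSymmetric.apply_eigenvectorBasis rfl, hA.nonneg_eigenvalues rfl⟩

theorem IsEigenbasis.inner_apply (h : IsEigenbasis A e a) (i : ι) (v : H) :
    ⟪e i, A v⟫_𝕜 = a i * ⟪e i, v⟫_𝕜 := by
  classical
  conv_lhs => rw [← e.sum_repr' v]
  simp only [map_sum, map_smul, h _, inner_sum, inner_smul_right, e.inner_eq_ite]
  simp [mul_comm]

theorem IsEigenbasis.isSymmetric (h : IsEigenbasis A e a) : A.IsSymmetric := by
  intro u v
  rw [← e.sum_inner_mul_inner, ← e.sum_inner_mul_inner u]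
  refine Finset.sum_congr rfl fun i _ => ?_
  rw [h.inner_apply, ← inner_conj_symm (A u), h.inner_apply, map_mul, inner_conj_symm,
    RCLike.conj_ofReal]
  ring

theorem IsEigenbasis.regularize (h : IsEigenbasis A e a) (ε : ℝ) :
    IsEigenbasis (regularize ε A) e (fun i => a i + ε) := by
  intro i
  simp [QuantumEntropy.regularize, h i, add_smul]

theorem applyFun_apply_of_apply_eq_smul [FiniteDimensional 𝕜 H] (hA : A.IsSymmetric) (f : ℝ → ℝ)
    {v : H} (hv : v ≠ 0) {r : ℝ} (h : A v = (r : 𝕜) • v) :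
    applyFun f A v = (f r : 𝕜) • v := by
  have hmem : v ∈ Module.End.eigenspace A (r : 𝕜) := Module.End.mem_eigenspace_iff.2 h
  have hev : Module.End.HasEigenvalue A (r : 𝕜) :=
    Module.End.hasEigenvalue_of_hasEigenvector ⟨hmem, hv⟩
  obtain ⟨μ₀, hμ₀⟩ : ∃ μ₀ : Module.End.Eigenvalues A, (μ₀ : 𝕜) = r := ⟨⟨r, hev⟩, rfl⟩
  rw [applyFun, LinearMap.sum_apply]
  refine (Finset.sum_eq_single μ₀ (fun μ _ hμ => ?_)
    fun h => absurd (Finset.mem_univ _) h).trans ?_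
  · have hne : (μ : 𝕜) ≠ (r : 𝕜) := fun hh => hμ (Subtype.ext (hh.trans hμ₀.symm))
    have : (Module.End.eigenspace A (μ : 𝕜)).starProjection v = 0 := by
      rw [Submodule.starProjection_apply_eq_zero_iff]
      intro u hu
      exact hA.orthogonalFamily_eigenspaces hne ⟨u, hu⟩ ⟨v, hmem⟩
    rw [LinearMap.smul_apply, ContinuousLinearMap.coe_coe, this, smul_zero]
  · have : (Module.End.eigenspace A (μ₀ : 𝕜)).starProjection v = v :=
      Submodule.starProjection_eq_self_iff.2 (by rwa [hμ₀])
    rw [LinearMap.smul_apply, ContinuousLinearMap.coe_coe, this, hμ₀, RCLike.ofReal_re]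

theorem IsEigenbasis.applyFun [FiniteDimensional 𝕜 H] (h : IsEigenbasis A e a) (f : ℝ → ℝ) :
    IsEigenbasis (applyFun f A) e (f ∘ a) := fun i =>
  applyFun_apply_of_apply_eq_smul h.isSymmetric f (e.orthonormal.ne_zero i) (h i)

/-- The weights `|⟨gⱼ, eᵢ⟩|²`. For eigenbases of two density operators, they turn the relative
entropy of the operators into a sum over pairs of eigenvalues. -/
noncomputable def overlap (e : OrthonormalBasis ι 𝕜 H) (g : OrthonormalBasis κ 𝕜 H)
    (k : ι × κ) : ℝ :=
  ‖⟪g k.2, e k.1⟫_𝕜‖ ^ 2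

theorem overlap_nonneg (k : ι × κ) : 0 ≤ overlap e g k := sq_nonneg _

theorem sum_overlap_mul (r : ι → ℝ) : ∑ k, overlap e g k * r k.1 = ∑ i, r i := by
  rw [Fintype.sum_prod_type]
  refine Finset.sum_congr rfl fun i _ => ?_
  simp only [overlap]
  rw [← Finset.sum_mul, g.sum_sq_norm_inner_right, e.norm_eq_one]
  simp

theorem IsEigenbasis.trace_comp (hA : IsEigenbasis A e a) (hB : IsEigenbasis B g b) :
    LinearMap.trace 𝕜 H (A ∘ₗ B) = ((∑ k, overlap e g k * (a k.1 * b k.2) : ℝ) : 𝕜) := by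
  rw [LinearMap.trace_eq_sum_inner _ e, Fintype.sum_prod_type]
  simp only [RCLike.ofReal_sum, RCLike.ofReal_mul]
  refine Finset.sum_congr rfl fun i _ => ?_
  rw [LinearMap.comp_apply, hA.inner_apply, ← g.sum_inner_mul_inner, Finset.mul_sum]
  refine Finset.sum_congr rfl fun j _ => ?_
  have hw : ((overlap e g (i, j) : ℝ) : 𝕜) = ⟪e i, g j⟫_𝕜 * ⟪g j, e i⟫_𝕜 := by
    rw [← inner_conj_symm, RCLike.conj_mul, overlap]
    simp
  rw [hB.inner_apply, hw]
  ring

theorem IsEigenbasis.trace (hA : IsEigenbasis A e a) :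
    LinearMap.trace 𝕜 H A = ((∑ i, a i : ℝ) : 𝕜) := by
  rw [LinearMap.trace_eq_sum_inner _ e]
  simp [hA _, inner_smul_right]

theorem IsDensityOperator.sum_overlap_mul (hA : IsDensityOperator A) (h : IsEigenbasis A e a) :
    ∑ k, overlap e g k * a k.1 = 1 := by
  rw [QuantumEntropy.sum_overlap_mul]
  have := h.trace.symm.trans hA.trace_eq_one
  exact_mod_cast this

theorem entropyTrace_eq_sum [FiniteDimensional 𝕜 H] (hA : IsEigenbasis A e a)
    (hB : IsEigenbasis B g b) :
    entropyTrace A B = ∑ k, overlap e g k * (a k.1 * (Real.log (a k.1) - Real.log (b k.2))) := by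
  have h1 : IsEigenbasis (A ∘ₗ logOp A) e (fun i => a i * Real.log (a i)) := by
    intro i
    have := hA.applyFun Real.log i
    simp only [LinearMap.comp_apply, logOp, this, map_smul, hA i, smul_smul, Function.comp]
    push_cast
    rw [mul_comm]
  rw [entropyTrace, map_sub, h1.trace, hA.trace_comp (B := logOp B) (hB.applyFun Real.log),
    ← RCLike.ofReal_sub, RCLike.ofReal_re, ← QuantumEntropy.sum_overlap_mul (e := e) (g := g),
    ← Finset.sum_sub_distrib]
  exact Finset.sum_congr rfl fun k _ => by simp only [Function.comp]; ring

theorem IsEigenbasis.mem_supp_iff (hA : IsEigenbasis A e a) (ha : ∀ i, 0 ≤ a i) {v : H} :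
    v ∈ supp A ↔ ∀ i, a i = 0 → ⟪e i, v⟫_𝕜 = 0 := by
  constructor
  · intro hv i hi
    have hle : supp A ≤ (𝕜 ∙ e i)ᗮ := by
      refine iSup₂_le fun μ hμ u hu => ?_
      rw [Submodule.mem_orthogonal_singleton_iff_inner_right]
      have h1 := hA.inner_apply i u
      rw [Module.End.mem_eigenspace_iff.1 hu, hi, inner_smul_right] at h1
      simpa [hμ.ne'] using h1
    exact Submodule.mem_orthogonal_singleton_iff_inner_right.1 (hle hv)
  · intro h
    rw [← e.sum_repr' v]
    refine Submodule.sum_mem _ fun i _ => ?_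
    rcases (ha i).eq_or_lt with hi | hi
    · simp [h i hi.symm]
    · exact Submodule.smul_mem _ _ (Submodule.mem_iSup_of_mem (a i)
        (Submodule.mem_iSup_of_mem hi (Module.End.mem_eigenspace_iff.2 (hA i))))

theorem supp_le_supp_iff (hA : IsEigenbasis A e a) (ha : ∀ i, 0 ≤ a i)
    (hB : IsEigenbasis B g b) (hb : ∀ i, 0 ≤ b i) :
    supp A ≤ supp B ↔ ∀ k, overlap e g k ≠ 0 → a k.1 ≠ 0 → b k.2 ≠ 0 := by
  classical
  constructor
  · rintro h ⟨i, j⟩ hw hi hj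
    have hmem : e i ∈ supp A := (hA.mem_supp_iff ha).2 fun i' hi' => by
      rw [e.inner_eq_ite, if_neg]
      rintro rfl
      exact hi hi'
    exact hw (by simp [overlap, (hB.mem_supp_iff hb).1 (h hmem) j hj])
  · intro h v hv
    rw [hB.mem_supp_iff hb]
    intro j hj
    rw [← e.sum_inner_mul_inner]
    refine Finset.sum_eq_zero fun i _ => ?_
    by_cases hi : a i = 0
    · rw [(hA.mem_supp_iff ha).1 hv i hi, mul_zero]
    · have : overlap e g (i, j) = 0 := by
        by_contra hw
        exact h (i, j) hw hi hj
      have : ⟪g j, e i⟫_𝕜 = 0 := by simpa [overlap] using this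
      rw [this, zero_mul]

/-- The regularized relative entropy converges to the support-based one. -/
theorem tendsto_entropyTrace_regularize [FiniteDimensional 𝕜 H] {ρ σ : H →ₗ[𝕜] H}
    (hρ : ρ.IsPositive) (hσ : σ.IsPositive) :
    Tendsto (fun ε : ℝ => ((entropyTrace (regularize ε ρ) (regularize ε σ) : ℝ) : EReal))
      (𝓝[>] 0) (𝓝 (relEntropy ρ σ)) := by
  obtain ⟨e, p, he, hp⟩ := exists_isEigenbasis hρ
  obtain ⟨g, q, hg, hq⟩ := exists_isEigenbasis hσ
  simp_rw [entropyTrace_eq_sum (he.regularize _) (hg.regularize _)]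
  rw [relEntropy]
  split_ifs with hs
  · rw [entropyTrace_eq_sum he hg, EReal.tendsto_coe]
    exact tendsto_regularized_sum (w := overlap e g) (p := fun k => p k.1) (q := fun k => q k.2)
      ((supp_le_supp_iff he hp hg hq).1 hs)
  · rw [EReal.tendsto_coe_nhds_top_iff]
    rw [supp_le_supp_iff he hp hg hq] at hs
    push Not at hs
    exact tendsto_regularized_sum_atTop (w := overlap e g) (p := fun k => p k.1)
      (q := fun k => q k.2) overlap_nonneg (fun k => hp _) (fun k => hq _) hs

end Spectral

end QuantumEntropy

/-! ### The variational formula and monotonicity -/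

namespace QuantumEntropy

section Variational

variable {𝕜 : Type*} [RCLike 𝕜] {H : Type*} [NormedAddCommGroup H] [InnerProductSpace 𝕜 H]
  [FiniteDimensional 𝕜 H]
  {ι κ : Type*} [Fintype ι] [Fintype κ] {ρ σ : H →ₗ[𝕜] H}
  {e : OrthonormalBasis ι 𝕜 H} {p : ι → ℝ} {g : OrthonormalBasis κ 𝕜 H} {q : κ → ℝ}

theorem IsEigenbasis.trace_adjoint_comp (hρ : IsEigenbasis ρ e p) (g : OrthonormalBasis κ 𝕜 H)
    (Y : H →ₗ[𝕜] H) :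
    LinearMap.trace 𝕜 H (Y.adjoint ∘ₗ ρ) =
      ∑ k : ι × κ, (p k.1 : 𝕜) * (⟪Y (e k.1), g k.2⟫_𝕜 * ⟪g k.2, e k.1⟫_𝕜) := by
  rw [LinearMap.trace_eq_sum_inner _ e, Fintype.sum_prod_type]
  refine Finset.sum_congr rfl fun i _ => ?_
  rw [LinearMap.comp_apply, hρ i, map_smul, inner_smul_right, LinearMap.adjoint_inner_right,
    ← g.sum_inner_mul_inner, Finset.mul_sum]

theorem IsEigenbasis.re_trace_adjoint_conj (hσ : IsEigenbasis σ g q)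
    (e : OrthonormalBasis ι 𝕜 H) (Y : H →ₗ[𝕜] H) :
    RCLike.re (LinearMap.trace 𝕜 H (Y.adjoint ∘ₗ σ ∘ₗ Y)) =
      ∑ k : ι × κ, q k.2 * ‖⟪g k.2, Y (e k.1)⟫_𝕜‖ ^ 2 := by
  rw [LinearMap.trace_eq_sum_inner _ e, Fintype.sum_prod_type, map_sum]
  refine Finset.sum_congr rfl fun i _ => ?_
  rw [LinearMap.comp_apply, LinearMap.comp_apply, LinearMap.adjoint_inner_right,
    ← g.sum_inner_mul_inner, map_sum]
  refine Finset.sum_congr rfl fun j _ => ?_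
  rw [hσ.inner_apply, ← inner_conj_symm, mul_left_comm, RCLike.conj_mul, RCLike.re_ofReal_mul,
    ← RCLike.ofReal_pow, RCLike.ofReal_re]

theorem IsEigenbasis.re_trace_conj_adjoint (hρ : IsEigenbasis ρ e p)
    (g : OrthonormalBasis κ 𝕜 H) (Y : H →ₗ[𝕜] H) :
    RCLike.re (LinearMap.trace 𝕜 H (Y ∘ₗ ρ ∘ₗ Y.adjoint)) =
      ∑ k : ι × κ, p k.1 * ‖⟪g k.2, Y (e k.1)⟫_𝕜‖ ^ 2 := by
  rw [← LinearMap.comp_assoc, LinearMap.trace_comp_comm', LinearMap.trace_eq_sum_inner _ e,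
    Fintype.sum_prod_type, map_sum]
  refine Finset.sum_congr rfl fun i _ => ?_
  rw [LinearMap.comp_apply, LinearMap.comp_apply, LinearMap.adjoint_inner_right, hρ i, map_smul,
    inner_smul_right, RCLike.re_ofReal_mul, inner_self_eq_norm_sq, ← g.sum_sq_norm_inner_right,
    Finset.mul_sum]

/-- The quadratic functional `2 Re Tr(Y⋆ρ) - Tr(Y⋆σY) - t Tr(YρY⋆)` of `Y`. -/
noncomputable def variationalForm (ρ σ : H →ₗ[𝕜] H) (t : ℝ) (Y : H →ₗ[𝕜] H) : ℝ :=
  2 * RCLike.re (LinearMap.trace 𝕜 H (Y.adjoint ∘ₗ ρ)) -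
    RCLike.re (LinearMap.trace 𝕜 H (Y.adjoint ∘ₗ σ ∘ₗ Y)) -
    t * RCLike.re (LinearMap.trace 𝕜 H (Y ∘ₗ ρ ∘ₗ Y.adjoint))

theorem variationalForm_eq_sum (hρ : IsEigenbasis ρ e p) (hσ : IsEigenbasis σ g q) (t : ℝ)
    (Y : H →ₗ[𝕜] H) :
    variationalForm ρ σ t Y = ∑ k : ι × κ,
      (2 * p k.1 * RCLike.re (⟪Y (e k.1), g k.2⟫_𝕜 * ⟪g k.2, e k.1⟫_𝕜) -
        (q k.2 + t * p k.1) * ‖⟪g k.2, Y (e k.1)⟫_𝕜‖ ^ 2) := by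
  rw [variationalForm, hρ.trace_adjoint_comp g, hσ.re_trace_adjoint_conj e,
    hρ.re_trace_conj_adjoint g, map_sum, Finset.mul_sum, Finset.mul_sum,
    ← Finset.sum_sub_distrib, ← Finset.sum_sub_distrib]
  refine Finset.sum_congr rfl fun k _ => ?_
  rw [RCLike.re_ofReal_mul]
  ring

/-- The bound is the maximum of the form, see `exists_variationalForm_eq`. A denominator can only
vanish together with `p`, so the corresponding term is `0 / 0 = 0`, as it should be. -/
theorem variationalForm_le (hρ : IsEigenbasis ρ e p) (hσ : IsEigenbasis σ g q)
    (hp : ∀ i, 0 ≤ p i) (hq : ∀ j, 0 ≤ q j) {t : ℝ} (ht : 0 < t) (Y : H →ₗ[𝕜] H) :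
    variationalForm ρ σ t Y ≤
      ∑ k : ι × κ, overlap e g k * (p k.1 ^ 2 / (q k.2 + t * p k.1)) := by
  rw [variationalForm_eq_sum hρ hσ]
  refine Finset.sum_le_sum fun k _ => ?_
  rcases (hp k.1).eq_or_lt with h | h
  · simp only [← h, mul_zero, zero_mul, zero_sub, add_zero]
    have := mul_nonneg (hq k.2) (sq_nonneg ‖⟪g k.2, Y (e k.1)⟫_𝕜‖)
    simpa using this
  · have hd : 0 < q k.2 + t * p k.1 := add_pos_of_nonneg_of_pos (hq _) (mul_pos ht h)
    have hre : RCLike.re (⟪Y (e k.1), g k.2⟫_𝕜 * ⟪g k.2, e k.1⟫_𝕜) ≤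
        ‖⟪g k.2, Y (e k.1)⟫_𝕜‖ * ‖⟪g k.2, e k.1⟫_𝕜‖ := by
      refine (RCLike.re_le_norm _).trans ?_
      rw [norm_mul, norm_inner_symm]
    rw [overlap]
    generalize q k.2 + t * p k.1 = d at *
    generalize p k.1 = r at *
    generalize ‖⟪g k.2, Y (e k.1)⟫_𝕜‖ = y at *
    generalize ‖⟪g k.2, e k.1⟫_𝕜‖ = c at *
    rw [← mul_div_assoc, le_div_iff₀ hd]
    have h1 := mul_le_mul_of_nonneg_left hre (mul_nonneg hd.le h.le)
    nlinarith [sq_nonneg (r * c - d * y)]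

theorem exists_variationalForm_eq (hρ : IsEigenbasis ρ e p) (hσ : IsEigenbasis σ g q) (t : ℝ) :
    ∃ Y : H →ₗ[𝕜] H, variationalForm ρ σ t Y =
      ∑ k : ι × κ, overlap e g k * (p k.1 ^ 2 / (q k.2 + t * p k.1)) := by
  classical
  -- Completing the square in each matrix entry gives the maximizer.
  let Y : H →ₗ[𝕜] H := e.toBasis.constr 𝕜 fun i =>
    ∑ j, (((p i / (q j + t * p i) : ℝ) : 𝕜) * ⟪g j, e i⟫_𝕜) • g j
  have hY : ∀ k : ι × κ, ⟪g k.2, Y (e k.1)⟫_𝕜 =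
      ((p k.1 / (q k.2 + t * p k.1) : ℝ) : 𝕜) * ⟪g k.2, e k.1⟫_𝕜 := by
    rintro ⟨i, j⟩
    have : Y (e i) = ∑ j, (((p i / (q j + t * p i) : ℝ) : 𝕜) * ⟪g j, e i⟫_𝕜) • g j := by
      rw [← e.coe_toBasis]
      exact e.toBasis.constr_basis 𝕜 _ i
    simp only [this, inner_sum, inner_smul_right, g.inner_eq_ite]
    simp
  refine ⟨Y, (variationalForm_eq_sum hρ hσ t Y).trans (Finset.sum_congr rfl fun k _ => ?_)⟩
  rw [← inner_conj_symm, hY, map_mul (starRingEnd 𝕜), RCLike.conj_ofReal,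
    mul_assoc ((_ : ℝ) : 𝕜), RCLike.conj_mul,
    ← RCLike.ofReal_pow, ← RCLike.ofReal_mul, RCLike.ofReal_re, norm_mul, RCLike.norm_ofReal,
    mul_pow, sq_abs, overlap]
  by_cases hd : q k.2 + t * p k.1 = 0
  · simp [hd]
  · field_simp
    ring

variable {K : Type*} [NormedAddCommGroup K] [InnerProductSpace 𝕜 K] [FiniteDimensional 𝕜 K]

/-- A pair `(ρ', σ')` has smaller relative entropy than `(ρ, σ)` if every test operator `Y` for
`(ρ', σ')` is matched by a test operator `X` for `(ρ, σ)` with the same linear term and no larger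
quadratic terms of the variational form. For `(ρ', σ') = (Φ ρ, Φ σ)`, the adjoint map takes `Y` to such an `X`. -/
theorem relEntropy_le_of_forall_exists {ρ' σ' : K →ₗ[𝕜] K}
    (hρ : IsDensityOperator ρ) (hσ : σ.IsPositive)
    (hρ' : IsDensityOperator ρ') (hσ' : σ'.IsPositive)
    (h : ∀ Y : K →ₗ[𝕜] K, ∃ X : H →ₗ[𝕜] H,
      LinearMap.trace 𝕜 K (Y.adjoint ∘ₗ ρ') = LinearMap.trace 𝕜 H (X.adjoint ∘ₗ ρ) ∧
      RCLike.re (LinearMap.trace 𝕜 H (X.adjoint ∘ₗ σ ∘ₗ X)) ≤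
        RCLike.re (LinearMap.trace 𝕜 K (Y.adjoint ∘ₗ σ' ∘ₗ Y)) ∧
      RCLike.re (LinearMap.trace 𝕜 H (X ∘ₗ ρ ∘ₗ X.adjoint)) ≤
        RCLike.re (LinearMap.trace 𝕜 K (Y ∘ₗ ρ' ∘ₗ Y.adjoint))) :
    relEntropy ρ' σ' ≤ relEntropy ρ σ := by
  obtain ⟨e, p, he, hp⟩ := exists_isEigenbasis hρ.isPositive
  obtain ⟨g, q, hg, hq⟩ := exists_isEigenbasis hσ
  obtain ⟨e', p', he', hp'⟩ := exists_isEigenbasis hρ'.isPositive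
  obtain ⟨g', q', hg', hq'⟩ := exists_isEigenbasis hσ'
  have hle : ∀ t, 0 < t → ∑ k, overlap e' g' k * (p' k.1 ^ 2 / (q' k.2 + t * p' k.1)) ≤
      ∑ k, overlap e g k * (p k.1 ^ 2 / (q k.2 + t * p k.1)) := by
    intro t ht
    obtain ⟨Y, hY⟩ := exists_variationalForm_eq he' hg' t
    obtain ⟨X, h1, h2, h3⟩ := h Y
    rw [← hY]
    refine le_trans ?_ (variationalForm_le he hg hp hq ht X)
    have := mul_le_mul_of_nonneg_left h3 ht.le
    rw [variationalForm, variationalForm, h1]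
    linarith
  by_cases hs : supp ρ ≤ supp σ
  · have hsupp := (supp_le_supp_iff he hp hg hq).1 hs
    have hsupp' := ne_zero_of_forall_sum_sq_div_le (w := overlap e g) (w' := overlap e' g')
      (p := fun k => p k.1) (q := fun k => q k.2) (p' := fun k => p' k.1) (q' := fun k => q' k.2)
      (fun k => hp _) (fun k => hq _) overlap_nonneg (fun k => hp' _) (fun k => hq' _)
      (hρ.sum_overlap_mul he) (hρ'.sum_overlap_mul he') hle hsupp
    rw [relEntropy, relEntropy, if_pos hs, if_pos ((supp_le_supp_iff he' hp' hg' hq').2 hsupp'),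
      entropyTrace_eq_sum he hg, entropyTrace_eq_sum he' hg', EReal.coe_le_coe_iff]
    exact sum_mul_log_sub_log_le (w := overlap e g) (w' := overlap e' g')
      (p := fun k => p k.1) (q := fun k => q k.2) (p' := fun k => p' k.1) (q' := fun k => q' k.2)
      (fun k => hp _) (fun k => hq _) (fun k => hp' _) (fun k => hq' _)
      (hρ.sum_overlap_mul he) (hρ'.sum_overlap_mul he') hle hsupp hsupp'
  · rw [relEntropy.eq_def ρ σ, if_neg hs]
    exact le_top

end Variational

end QuantumEntropy

/-! ### The partial trace -/

namespace QuantumEntropy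

theorem trace_comp_comp {R M : Type*} [CommRing R] [AddCommGroup M] [Module R M] [Module.Free R M]
    [Module.Finite R M] (A B C : M →ₗ[R] M) :
    LinearMap.trace R M (A ∘ₗ B ∘ₗ C) = LinearMap.trace R M ((C ∘ₗ A) ∘ₗ B) := by
  rw [← LinearMap.comp_assoc, LinearMap.trace_comp_comm', LinearMap.comp_assoc]

section PartialTrace

variable {𝕜 : Type*} [RCLike 𝕜]
  {Ha : Type*} [NormedAddCommGroup Ha] [InnerProductSpace 𝕜 Ha] [FiniteDimensional 𝕜 Ha]
  {Hb : Type*} [NormedAddCommGroup Hb] [InnerProductSpace 𝕜 Hb] [FiniteDimensional 𝕜 Hb]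

/-- An additive property of operators on a tensor product can be checked on the operators
`X ⊗ Y`. -/
theorem endTensor_induction {motive : (Ha ⊗[𝕜] Hb →ₗ[𝕜] Ha ⊗[𝕜] Hb) → Prop}
    (zero : motive 0) (map : ∀ X Y, motive (TensorProduct.map X Y))
    (add : ∀ S T, motive S → motive T → motive (S + T)) (T : Ha ⊗[𝕜] Hb →ₗ[𝕜] Ha ⊗[𝕜] Hb) :
    motive T := by
  obtain ⟨z, rfl⟩ := (homTensorHomEquiv 𝕜 Ha Hb Ha Hb).surjective T
  induction z using TensorProduct.induction_on with
  | zero => simpa using zero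
  | tmul X Y =>
    rw [homTensorHomEquiv_apply]
    exact map X Y
  | add x y hx hy => simpa using add _ _ hx hy

theorem inner_partialTrace {ι : Type*} [Fintype ι] (b : OrthonormalBasis ι 𝕜 Hb)
    (T : Ha ⊗[𝕜] Hb →ₗ[𝕜] Ha ⊗[𝕜] Hb) (u v : Ha) :
    ⟪u, partialTrace T v⟫_𝕜 = ∑ i, ⟪u ⊗ₜ[𝕜] b i, T (v ⊗ₜ[𝕜] b i)⟫_𝕜 := by
  induction T using endTensor_induction with
  | zero => simp
  | map X Y =>
    rw [partialTrace_map, LinearMap.trace_eq_sum_inner _ b]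
    simp [inner_smul_right, Finset.mul_sum, mul_comm]
  | add S T hS hT => simp [inner_add_right, hS, hT, Finset.sum_add_distrib]

theorem isPositive_partialTrace {T : Ha ⊗[𝕜] Hb →ₗ[𝕜] Ha ⊗[𝕜] Hb} (hT : T.IsPositive) :
    (partialTrace T).IsPositive := by
  have b := stdOrthonormalBasis 𝕜 Hb
  refine ⟨fun u v => ?_, fun u => ?_⟩
  · rw [← inner_conj_symm, inner_partialTrace b, inner_partialTrace b, map_sum]
    refine Finset.sum_congr rfl fun i _ => ?_
    rw [inner_conj_symm, hT.isSymmetric]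
  · rw [inner_re_symm, inner_partialTrace b, map_sum]
    exact Finset.sum_nonneg fun i _ => hT.re_inner_nonneg_right _

/-- The partial trace is adjoint to `Y ↦ Y ⊗ 1`. -/
theorem trace_comp_partialTrace (T : Ha ⊗[𝕜] Hb →ₗ[𝕜] Ha ⊗[𝕜] Hb) (Y : Ha →ₗ[𝕜] Ha) :
    LinearMap.trace 𝕜 Ha (Y ∘ₗ partialTrace T) =
      LinearMap.trace 𝕜 (Ha ⊗[𝕜] Hb) (TensorProduct.map Y LinearMap.id ∘ₗ T) := by
  induction T using endTensor_induction with
  | zero => simp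
  | map X Z =>
    rw [partialTrace_map, ← TensorProduct.map_comp, LinearMap.trace_tensorProduct',
      LinearMap.comp_smul, map_smul, smul_eq_mul, LinearMap.id_comp, mul_comm]
  | add S T hS hT => simp [LinearMap.comp_add, hS, hT]

theorem IsDensityOperator.partialTrace {ρ : Ha ⊗[𝕜] Hb →ₗ[𝕜] Ha ⊗[𝕜] Hb}
    (hρ : IsDensityOperator ρ) : IsDensityOperator (partialTrace ρ) := by
  refine ⟨isPositive_partialTrace hρ.isPositive, ?_⟩
  have := trace_comp_partialTrace ρ LinearMap.id
  rwa [TensorProduct.map_id, LinearMap.id_comp, LinearMap.id_comp, hρ.trace_eq_one] at this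

theorem relEntropy_partialTrace_le {ρ σ : Ha ⊗[𝕜] Hb →ₗ[𝕜] Ha ⊗[𝕜] Hb}
    (hρ : IsDensityOperator ρ) (hσ : IsDensityOperator σ) :
    relEntropy (partialTrace ρ) (partialTrace σ) ≤ relEntropy ρ σ := by
  refine relEntropy_le_of_forall_exists hρ hσ.isPositive hρ.partialTrace
    hσ.partialTrace.isPositive fun Y => ⟨TensorProduct.map Y LinearMap.id, ?_, ?_, ?_⟩
  · rw [trace_comp_partialTrace, TensorProduct.adjoint_map, LinearMap.adjoint_id]
  · rw [trace_comp_comp, trace_comp_comp, trace_comp_partialTrace, TensorProduct.adjoint_map,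
      LinearMap.adjoint_id, ← TensorProduct.map_comp, LinearMap.id_comp]
  · rw [trace_comp_comp, trace_comp_comp, trace_comp_partialTrace, TensorProduct.adjoint_map,
      LinearMap.adjoint_id, ← TensorProduct.map_comp, LinearMap.id_comp]

end PartialTrace

/-! ### Channels -/

section Channel

variable {𝕜 : Type*} [RCLike 𝕜]
  {H : Type*} [NormedAddCommGroup H] [InnerProductSpace 𝕜 H]
  {K : Type*} [NormedAddCommGroup K] [InnerProductSpace 𝕜 K]

/-- The column `v ↦ ∑ₖ Xₖ v ⊗ uₖ` of the operators `Xₖ`, with `u` the standard basis of `𝕜ⁿ`. -/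
noncomputable def column {n : ℕ} (X : Fin n → (H →ₗ[𝕜] K)) :
    H →ₗ[𝕜] K ⊗[𝕜] EuclideanSpace 𝕜 (Fin n) :=
  ∑ k, (TensorProduct.mk 𝕜 K (EuclideanSpace 𝕜 (Fin n))).flip
    (EuclideanSpace.basisFun (Fin n) 𝕜 k) ∘ₗ X k

theorem column_apply {n : ℕ} (X : Fin n → (H →ₗ[𝕜] K)) (v : H) :
    column X v = ∑ k, X k v ⊗ₜ[𝕜] EuclideanSpace.basisFun (Fin n) 𝕜 k := by
  simp [column]

/-- The matrix unit `|uₖ⟩⟨uₗ|` of the standard basis `u` of `𝕜ⁿ`. -/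
noncomputable def matrixUnit {n : ℕ} (k l : Fin n) :
    EuclideanSpace 𝕜 (Fin n) →ₗ[𝕜] EuclideanSpace 𝕜 (Fin n) :=
  (InnerProductSpace.rankOne 𝕜 (EuclideanSpace.basisFun (Fin n) 𝕜 k)
    (EuclideanSpace.basisFun (Fin n) 𝕜 l)).toLinearMap

theorem matrixUnit_apply {n : ℕ} (k l : Fin n) (z : EuclideanSpace 𝕜 (Fin n)) :
    matrixUnit (𝕜 := 𝕜) k l z = ⟪EuclideanSpace.basisFun (Fin n) 𝕜 l, z⟫_𝕜 •
      EuclideanSpace.basisFun (Fin n) 𝕜 k := by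
  simp [matrixUnit, -EuclideanSpace.basisFun_apply]

theorem inner_sum_map_matrixUnit {n : ℕ} (T : Fin n → Fin n → (K →ₗ[𝕜] K)) (u v : K)
    (i j : Fin n) :
    ⟪u ⊗ₜ[𝕜] EuclideanSpace.basisFun (Fin n) 𝕜 i,
      (∑ k, ∑ l, TensorProduct.map (T k l) (matrixUnit k l))
        (v ⊗ₜ[𝕜] EuclideanSpace.basisFun (Fin n) 𝕜 j)⟫_𝕜 = ⟪u, T i j v⟫_𝕜 := by
  simp only [LinearMap.sum_apply, inner_sum, TensorProduct.map_tmul, matrixUnit_apply,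
    OrthonormalBasis.inner_eq_ite, TensorProduct.inner_tmul, inner_smul_right]
  simp

variable [FiniteDimensional 𝕜 H] [FiniteDimensional 𝕜 K]
  {Φ : (H →ₗ[𝕜] H) →ₗ[𝕜] (K →ₗ[𝕜] K)}

theorem adjoint_column_tmul {n : ℕ} (X : Fin n → (H →ₗ[𝕜] K)) (v : K)
    (z : EuclideanSpace 𝕜 (Fin n)) :
    (column X).adjoint (v ⊗ₜ z) =
      ∑ k, ⟪EuclideanSpace.basisFun (Fin n) 𝕜 k, z⟫_𝕜 • (X k).adjoint v := by
  refine ext_inner_left 𝕜 fun u => ?_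
  rw [LinearMap.adjoint_inner_right, column_apply, sum_inner, inner_sum]
  refine Finset.sum_congr rfl fun k _ => ?_
  rw [TensorProduct.inner_tmul, inner_smul_right, LinearMap.adjoint_inner_right, mul_comm]

theorem column_comp_comp_adjoint {n : ℕ} (X : Fin n → (H →ₗ[𝕜] K)) (σ : H →ₗ[𝕜] H) :
    column X ∘ₗ σ ∘ₗ (column X).adjoint =
      ∑ k, ∑ l, TensorProduct.map (X k ∘ₗ σ ∘ₗ (X l).adjoint) (matrixUnit k l) := by
  refine TensorProduct.ext' fun v z => ?_
  simp only [LinearMap.comp_apply, LinearMap.sum_apply, TensorProduct.map_tmul, matrixUnit_apply,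
    adjoint_column_tmul, column_apply, map_sum, map_smul, TensorProduct.tmul_smul, Finset.smul_sum]
  exact Finset.sum_comm

/-- Complete positivity in block form: applying `Φ` to each block of the positive block operator
`(Xₖ σ Xₗ⋆)ₖₗ` yields a positive block operator. -/
theorem IsChannel.isPositive_sum_map (hΦ : IsChannel Φ) {σ : H →ₗ[𝕜] H} (hσ : σ.IsPositive)
    {n : ℕ} (X : Fin n → (H →ₗ[𝕜] H)) :
    (∑ k, ∑ l, TensorProduct.map (Φ (X k ∘ₗ σ ∘ₗ (X l).adjoint))
      (matrixUnit (𝕜 := 𝕜) k l)).IsPositive := by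
  have h := hΦ.completely_positive n _ (hσ.conj_adjoint (column X))
  rw [column_comp_comp_adjoint] at h
  simpa only [map_sum, ampliation_map] using h

theorem IsChannel.isPositive_apply (hΦ : IsChannel Φ) {σ : H →ₗ[𝕜] H} (hσ : σ.IsPositive) :
    (Φ σ).IsPositive := by
  have h := hΦ.isPositive_sum_map hσ (n := 1) fun _ => LinearMap.id
  have hin := inner_sum_map_matrixUnit (n := 1)
    (fun _ _ => Φ (LinearMap.id ∘ₗ σ ∘ₗ LinearMap.id.adjoint))
  simp only [LinearMap.adjoint_id, LinearMap.id_comp, LinearMap.comp_id] at h hin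
  refine ⟨fun u v => ?_, fun u => ?_⟩
  · rw [← inner_conj_symm, ← hin v u 0 0, ← hin u v 0 0]
    exact (inner_conj_symm _ _).trans (h.isSymmetric _ _)
  · rw [inner_re_symm, ← hin u u 0 0]
    exact h.re_inner_nonneg_right _

theorem IsChannel.isDensityOperator_apply (hΦ : IsChannel Φ) {ρ : H →ₗ[𝕜] H}
    (hρ : IsDensityOperator ρ) : IsDensityOperator (Φ ρ) :=
  ⟨hΦ.isPositive_apply hρ.isPositive, by rw [hΦ.trace_preserving, hρ.trace_eq_one]⟩

/-- The amplification of `Φ` maps the positive block operator with blocks `1`, `Z⋆`, `Z`, `ZZ⋆` to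
a symmetric one, whose off-diagonal blocks are adjoint to each other. Positivity of `Φ` alone would
not be enough over `ℝ`. -/
theorem IsChannel.apply_adjoint (hΦ : IsChannel Φ) (Z : H →ₗ[𝕜] H) :
    Φ Z.adjoint = (Φ Z).adjoint := by
  have h := hΦ.isPositive_sum_map LinearMap.isPositive_id ![LinearMap.id, Z]
  have hin := inner_sum_map_matrixUnit (n := 2)
    (fun k l => Φ ((![LinearMap.id, Z] : Fin 2 → (H →ₗ[𝕜] H)) k ∘ₗ LinearMap.id ∘ₗ
      ((![LinearMap.id, Z] : Fin 2 → (H →ₗ[𝕜] H)) l).adjoint))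
  refine LinearMap.ext fun v => ext_inner_left 𝕜 fun u => ?_
  have h01 := hin u v 0 1
  have h10 := hin v u 1 0
  simp only [LinearMap.id_comp, LinearMap.adjoint_id, LinearMap.comp_id, Matrix.cons_val_zero,
    Matrix.cons_val_one] at h h01 h10
  rw [LinearMap.adjoint_inner_right, ← h01, ← inner_conj_symm (Φ Z u), ← h10]
  exact ((inner_conj_symm _ _).trans (h.isSymmetric _ _)).symm

/-- A Schwarz inequality for channels acting on states: compress the image of the positive block
operator with blocks `σ`, `σX`, `X⋆σ`, `X⋆σX` by the column `(Y, -1)`. -/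
theorem IsChannel.isPositive_schwarz (hΦ : IsChannel Φ) {σ : H →ₗ[𝕜] H} (hσ : σ.IsPositive)
    (X : H →ₗ[𝕜] H) (Y : K →ₗ[𝕜] K) :
    (Y.adjoint ∘ₗ Φ σ ∘ₗ Y - Y.adjoint ∘ₗ Φ (σ ∘ₗ X) - Φ (X.adjoint ∘ₗ σ) ∘ₗ Y +
      Φ (X.adjoint ∘ₗ σ ∘ₗ X)).IsPositive := by
  have h := (hΦ.isPositive_sum_map hσ ![LinearMap.id, X.adjoint]).conj_adjoint
    (column ![Y, -LinearMap.id]).adjoint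
  convert h using 1
  refine LinearMap.ext fun v => ?_
  simp only [LinearMap.adjoint_adjoint, LinearMap.comp_apply, column_apply, LinearMap.sum_apply,
    map_sum, TensorProduct.map_tmul, matrixUnit_apply, TensorProduct.tmul_smul, map_smul,
    adjoint_column_tmul, OrthonormalBasis.inner_eq_ite]
  simp [Fin.sum_univ_two]
  abel

theorem trace_adjoint (A : H →ₗ[𝕜] H) :
    LinearMap.trace 𝕜 H A.adjoint = starRingEnd 𝕜 (LinearMap.trace 𝕜 H A) := by
  have b := stdOrthonormalBasis 𝕜 H
  rw [LinearMap.trace_eq_sum_inner _ b, LinearMap.trace_eq_sum_inner _ b, map_sum]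
  refine Finset.sum_congr rfl fun i _ => ?_
  rw [LinearMap.adjoint_inner_right, inner_conj_symm]

/-- Finite-dimensional Riesz representation for the trace pairing: it identifies operators with
linear functionals on operators. -/
theorem exists_trace_comp_eq (φ : (H →ₗ[𝕜] H) →ₗ[𝕜] 𝕜) :
    ∃ X : H →ₗ[𝕜] H, ∀ Z, LinearMap.trace 𝕜 H (X ∘ₗ Z) = φ Z := by
  let F : (H →ₗ[𝕜] H) →ₗ[𝕜] Module.Dual 𝕜 (H →ₗ[𝕜] H) :=
    (LinearMap.llcomp 𝕜 H H H).compr₂ (LinearMap.trace 𝕜 H)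
  have hinj : Function.Injective F := by
    refine (injective_iff_map_eq_zero F).2 fun X hX => LinearMap.ext fun u => ?_
    have h : LinearMap.trace 𝕜 H
        (X ∘ₗ (InnerProductSpace.rankOne 𝕜 u (X u)).toLinearMap) = 0 := LinearMap.congr_fun hX _
    have hc : X ∘ₗ (InnerProductSpace.rankOne 𝕜 u (X u)).toLinearMap =
        (InnerProductSpace.rankOne 𝕜 (X u) (X u)).toLinearMap := by
      ext v
      simp
    rw [hc, InnerProductSpace.trace_rankOne, inner_self_eq_zero] at h
    exact h
  obtain ⟨X, hX⟩ := (LinearMap.injective_iff_surjective_of_finrank_eq_finrank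
    Subspace.dual_finrank_eq.symm).1 hinj φ
  exact ⟨X, fun Z => LinearMap.congr_fun hX Z⟩

/-- The image `X` of `Y` under the adjoint of a channel for the trace pairing. The second clause
says that the image of `Y⋆` is `X⋆`. -/
theorem IsChannel.exists_dual (hΦ : IsChannel Φ) (Y : K →ₗ[𝕜] K) :
    ∃ X : H →ₗ[𝕜] H,
      (∀ Z, LinearMap.trace 𝕜 K (Y ∘ₗ Φ Z) = LinearMap.trace 𝕜 H (X ∘ₗ Z)) ∧
      ∀ Z, LinearMap.trace 𝕜 K (Y.adjoint ∘ₗ Φ Z) = LinearMap.trace 𝕜 H (X.adjoint ∘ₗ Z) := by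
  obtain ⟨X, hX⟩ := exists_trace_comp_eq
    (LinearMap.trace 𝕜 K ∘ₗ LinearMap.llcomp 𝕜 K K K Y ∘ₗ Φ)
  have hX : ∀ Z, LinearMap.trace 𝕜 K (Y ∘ₗ Φ Z) = LinearMap.trace 𝕜 H (X ∘ₗ Z) :=
    fun Z => (hX Z).symm
  refine ⟨X, hX, fun Z => ?_⟩
  have h := congrArg (starRingEnd 𝕜) (hX Z.adjoint)
  rwa [← trace_adjoint, ← trace_adjoint, LinearMap.adjoint_comp, LinearMap.adjoint_comp,
    LinearMap.adjoint_adjoint, ← hΦ.apply_adjoint, LinearMap.adjoint_adjoint,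
    LinearMap.trace_comp_comm' Y.adjoint, LinearMap.trace_comp_comm' X.adjoint] at h

/-- The quadratic terms of the variational form do not increase along the dual of a channel. -/
theorem IsChannel.re_trace_conj_le (hΦ : IsChannel Φ) {σ : H →ₗ[𝕜] H} (hσ : σ.IsPositive)
    {X : H →ₗ[𝕜] H} {Y : K →ₗ[𝕜] K}
    (h : ∀ Z, LinearMap.trace 𝕜 K (Y ∘ₗ Φ Z) = LinearMap.trace 𝕜 H (X ∘ₗ Z))
    (h' : ∀ Z, LinearMap.trace 𝕜 K (Y.adjoint ∘ₗ Φ Z) = LinearMap.trace 𝕜 H (X.adjoint ∘ₗ Z)) :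
    RCLike.re (LinearMap.trace 𝕜 H (X.adjoint ∘ₗ σ ∘ₗ X)) ≤
      RCLike.re (LinearMap.trace 𝕜 K (Y.adjoint ∘ₗ Φ σ ∘ₗ Y)) := by
  have hpos := (RCLike.nonneg_iff.1 (hΦ.isPositive_schwarz hσ X Y).trace_nonneg).1
  have hcross : LinearMap.trace 𝕜 K (Φ (X.adjoint ∘ₗ σ) ∘ₗ Y) =
      LinearMap.trace 𝕜 H (X.adjoint ∘ₗ σ ∘ₗ X) := by
    rw [LinearMap.trace_comp_comm', h, trace_comp_comp, LinearMap.trace_comp_comm']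
  rw [map_add, map_sub, map_sub, h', hcross, hΦ.trace_preserving] at hpos
  simp only [map_add, map_sub] at hpos
  linarith

theorem IsChannel.relEntropy_le (hΦ : IsChannel Φ) {ρ σ : H →ₗ[𝕜] H}
    (hρ : IsDensityOperator ρ) (hσ : IsDensityOperator σ) :
    relEntropy (Φ ρ) (Φ σ) ≤ relEntropy ρ σ := by
  refine relEntropy_le_of_forall_exists hρ hσ.isPositive (hΦ.isDensityOperator_apply hρ)
    (hΦ.isPositive_apply hσ.isPositive) fun Y => ?_
  obtain ⟨X, h, h'⟩ := hΦ.exists_dual Y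
  refine ⟨X, h' ρ, hΦ.re_trace_conj_le hσ.isPositive h h', ?_⟩
  have := hΦ.re_trace_conj_le hρ.isPositive (X := X.adjoint) (Y := Y.adjoint) h'
    (by simpa only [LinearMap.adjoint_adjoint] using h)
  simpa only [LinearMap.adjoint_adjoint] using this

end Channel

end QuantumEntropy

theorem mainTheorem1 {𝕜 : Type*} [RCLike 𝕜] :
    -- the support-based and the regularized definitions of the relative entropy agree
    (∀ (H : Type*) [NormedAddCommGroup H] [InnerProductSpace 𝕜 H] [FiniteDimensional 𝕜 H]
      (ρ σ : H →ₗ[𝕜] H),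
      QuantumEntropy.IsDensityOperator ρ → QuantumEntropy.IsDensityOperator σ →
      Tendsto
        (fun ε : ℝ => ((QuantumEntropy.entropyTrace (QuantumEntropy.regularize ε ρ)
          (QuantumEntropy.regularize ε σ) : ℝ) : EReal))
        (𝓝[>] 0) (𝓝 (QuantumEntropy.relEntropy ρ σ))) ∧
    -- monotonicity under the partial trace
    (∀ (Ha Hb : Type*)
      [NormedAddCommGroup Ha] [InnerProductSpace 𝕜 Ha] [FiniteDimensional 𝕜 Ha]
      [NormedAddCommGroup Hb] [InnerProductSpace 𝕜 Hb] [FiniteDimensional 𝕜 Hb]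
      (ρ σ : Ha ⊗[𝕜] Hb →ₗ[𝕜] Ha ⊗[𝕜] Hb),
      QuantumEntropy.IsDensityOperator ρ → QuantumEntropy.IsDensityOperator σ →
      QuantumEntropy.IsDensityOperator (QuantumEntropy.partialTrace ρ) ∧
      QuantumEntropy.IsDensityOperator (QuantumEntropy.partialTrace σ) ∧
      QuantumEntropy.relEntropy (QuantumEntropy.partialTrace ρ) (QuantumEntropy.partialTrace σ) ≤
        QuantumEntropy.relEntropy ρ σ) ∧
    -- the data-processing inequality for channels
    (∀ (H K : Type*)
      [NormedAddCommGroup H] [InnerProductSpace 𝕜 H] [FiniteDimensional 𝕜 H]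
      [NormedAddCommGroup K] [InnerProductSpace 𝕜 K] [FiniteDimensional 𝕜 K]
      (Φ : (H →ₗ[𝕜] H) →ₗ[𝕜] (K →ₗ[𝕜] K)), QuantumEntropy.IsChannel Φ →
      ∀ ρ σ : H →ₗ[𝕜] H,
      QuantumEntropy.IsDensityOperator ρ → QuantumEntropy.IsDensityOperator σ →
      QuantumEntropy.IsDensityOperator (Φ ρ) ∧ QuantumEntropy.IsDensityOperator (Φ σ) ∧
      QuantumEntropy.relEntropy (Φ ρ) (Φ σ) ≤ QuantumEntropy.relEntropy ρ σ) := by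
  exact ⟨fun H _ _ _ ρ σ hρ hσ =>
      QuantumEntropy.tendsto_entropyTrace_regularize hρ.isPositive hσ.isPositive,
    fun Ha Hb _ _ _ _ _ _ ρ σ hρ hσ => ⟨hρ.partialTrace, hσ.partialTrace,
      QuantumEntropy.relEntropy_partialTrace_le hρ hσ⟩,
    fun H K _ _ _ _ _ _ Φ hΦ ρ σ hρ hσ => ⟨hΦ.isDensityOperator_apply hρ,
      hΦ.isDensityOperator_apply hσ, hΦ.relEntropy_le hρ hσ⟩⟩
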